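/- **Conventions.** Let $(K,\delta)$ be an ordinary differential field of characteristic $0$ (one derivation), and let $(\mathcal U,\delta)$ be any differential field extension of $(K,\delta)$ that is algebraically closed as a field (for example a saturated differentially closed field containing $K$). * A set $W\subseteq\mathcal U^N$ is *Zariski-closed over $K$* if it is the set of common zeros of polynomials with coefficients in $K$. It is a *$K$-irreducible Zariski-closed set* if it is Zariski-closed over $K$, nonempty, and not the union of two proper subsets that are Zariski-closed over $K$. A *smooth $K$-point* of $W$ is a point $a\in W\cap K^N$ at which the affine $K$-scheme $\operatorname{Spec} K[x_1,\dots,x_N]/I_K(W)$ is smooth over $K$, where $I_K(W)$ is the ideal of polynomials over $K$ vanishing on $W$. * A field $F$ is *large* if every irreducible affine algebraic variety over $F$ with a smooth $F$-point has a Zariski-dense set of $F$-points. * A field $F$ is *existentially closed as a field* in a field extension $L$ if every affine algebraic variety over $F$ with an $L$-point has an $F$-point. A differential field $K$ is *existentially closed as a differential field* in a differential field extension $L$ if every finite system of differential polynomial equations over $K$ (in finitely many differential indeterminates) that has a solution in $L$ has a solution in $K$. * A differential field $K$ is *differentially large* if it is large as a field and, for every differential field extension $L/K$ such that $K$ is existentially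 closed in $L$ as a field, $K$ is existentially closed in $L$ as a differential field. * $\pi:\mathcal U^{2n}\to\mathcal U^n$ is the projection onto the first $n$ coordinates. For $X\subseteq\mathcal U^n$, the prolongation $\tau_\delta(X)\subseteq\mathcal U^{2n}$ is the set of all $(x,y)$ with $x\in X$ and $$\sum_{i=1}^n\frac{\partial f}{\partial x_i}(x)\,y_i+f^\delta(x)=0$$ for all polynomials $f$ over $\mathcal U$ vanishing on $X$, where $f^\delta$ is obtained from $f$ by applying $\delta$ to its coefficients. **Corollary 8.5.** Assume that $K$ is large as a field. Then $(K,\delta)$ is differentially large if and only if the following condition holds: for every $n$ and every $K$-irreducible Zariski-closed set $W\subseteq\mathcal U^{2n}$ that has a smooth $K$-point and satisfies $W\subseteq\tau_\delta(\pi(W))$, there is $a\in K^n$ with $(a,\delta a)\in W$. -/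

import Mathlib

universe u

noncomputable section

open MvPolynomial

namespace DiffLarge

/-! ### Zariski-closed sets and smooth rational points -/

section Zariski

variable (K : Type*) [Field K] {U : Type*} [Field U] [Algebra K U] {σ : Type*}

/-- `W ⊆ U^σ` is Zariski-closed and defined over `K`: it is the set of common zeros of
polynomials with coefficients in `K`. -/
def IsClosedOver (W : Set (σ → U)) : Prop :=
  ∃ I : Ideal (MvPolynomial σ K), W = zeroLocus U I

/-- `W ⊆ U^σ` is a `K`-irreducible Zariski-closed set: it is Zariski-closed over `K`, nonempty,
and not the union of two proper subsets that are Zariski-closed over `K`. -/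
def IsIrreducibleClosedOver (W : Set (σ → U)) : Prop :=
  IsClosedOver K W ∧ W.Nonempty ∧
    ∀ W₁ W₂ : Set (σ → U), IsClosedOver K W₁ → IsClosedOver K W₂ →
      W = W₁ ∪ W₂ → W = W₁ ∨ W = W₂

variable {K}

/-- The `K`-rational point `a ∈ K^σ` is a zero of the ideal `I ⊆ K[x]` at which the affine
`K`-scheme `Spec K[x]/I` is smooth over `K`. -/
def IsSmoothZero (I : Ideal (MvPolynomial σ K)) (a : σ → K) : Prop :=
  ∃ p ∈ Algebra.smoothLocus K (MvPolynomial σ K ⧸ I),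
    p.asIdeal.comap (Ideal.Quotient.mk I) = RingHom.ker (eval a)

variable (K)

/-- `W ⊆ U^σ` has a smooth `K`-point, where `W` is regarded as a variety over `K` with
coordinate ring `K[x] / I_K(W)`. -/
def HasSmoothPoint (W : Set (σ → U)) : Prop :=
  ∃ a : σ → K, IsSmoothZero (vanishingIdeal K W) a

end Zariski

/-! ### Large fields and existential closedness -/

/-- A field `F` is large if every irreducible affine algebraic variety over `F` with a smooth
`F`-point has a Zariski-dense set of `F`-points. An irreducible affine variety over `F` is given
by a prime ideal `P` of a polynomial ring over `F`; density says that a polynomial vanishing at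
all the `F`-points vanishes on the variety. -/
def IsLargeField (F : Type*) [Field F] : Prop :=
  ∀ (n : ℕ) (P : Ideal (MvPolynomial (Fin n) F)), P.IsPrime →
    (∃ a : Fin n → F, IsSmoothZero P a) →
      vanishingIdeal F (zeroLocus F P) ≤ P

/-- `F` is existentially closed in `L` as a field: every affine algebraic variety over `F` with an
`L`-point has an `F`-point. -/
def IsECField (F L : Type*) [Field F] [Field L] [Algebra F L] : Prop :=
  ∀ (n : ℕ) (I : Ideal (MvPolynomial (Fin n) F)),
    (zeroLocus L I).Nonempty → (zeroLocus F I).Nonempty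

/-- The value at `a ∈ L^n` of an (ordinary) differential polynomial over `K` in `n` differential
indeterminates. The ring `K{x₁, …, xₙ}` is the polynomial ring over `K` in the algebraic
indeterminates `δʲ xᵢ`, which are indexed by the pairs `(i, j)`. -/
def diffEval {K L : Type*} [Field K] [Field L] [Differential L] [Algebra K L] {n : ℕ}
    (a : Fin n → L) (f : MvPolynomial (Fin n × ℕ) K) : L :=
  aeval (fun p : Fin n × ℕ => (fun x : L => Differential.deriv x)^[p.2] (a p.1)) f

/-- `K` is existentially closed in `L` as a differential field: every finite system of
differential polynomial equations over `K` that has a solution in `L` has a solution in `K`. -/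
def IsECDifferential (K L : Type*) [Field K] [Differential K] [Field L] [Differential L]
    [Algebra K L] : Prop :=
  ∀ (n : ℕ) (S : Finset (MvPolynomial (Fin n × ℕ) K)),
    (∃ a : Fin n → L, ∀ f ∈ S, diffEval a f = 0) →
      ∃ b : Fin n → K, ∀ f ∈ S, diffEval b f = 0

/-- A differential field `K` is differentially large if it is large as a field and existentially
closed, as a differential field, in every differential field extension in which it is existentially
closed as a field. -/
def IsDifferentiallyLarge (K : Type u) [Field K] [Differential K] : Prop :=
  IsLargeField K ∧
    ∀ (L : Type u) [Field L] [Differential L] [Algebra K L] [DifferentialAlgebra K L],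
      IsECField K L → IsECDifferential K L

/-! ### The prolongation of a constructible set -/

section Prolongation

variable {U : Type*} [Field U] [Differential U] {n : ℕ}

/-- The polynomial `f^δ`, obtained by applying the derivation to the coefficients of `f`. -/
def coeffDeriv {σ : Type*} (f : MvPolynomial σ U) : MvPolynomial σ U :=
  ∑ m ∈ f.support, monomial m (Differential.deriv (f.coeff m))

/-- The projection `π : U^{2n} → U^n` to the first `n` coordinates. Points of `U^{2n}` are
functions on `Fin n ⊕ Fin n`. -/
def proj {n : ℕ} (w : Fin n ⊕ Fin n → U) : Fin n → U := fun i => w (Sum.inl i)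

/-- The prolongation `τ_δ(X) ⊆ U^{2n}` of `X ⊆ U^n`: the pairs `(x, y)` with `x ∈ X` and
`∑ᵢ ∂f/∂xᵢ(x) yᵢ + f^δ(x) = 0` for every polynomial `f` over `U` that vanishes on `X`. -/
def prolongation (X : Set (Fin n → U)) : Set (Fin n ⊕ Fin n → U) :=
  {w | proj w ∈ X ∧ ∀ f ∈ vanishingIdeal U X,
    ∑ i, eval (proj w) (pderiv i f) * w (Sum.inr i) + eval (proj w) (coeffDeriv f) = 0}

end Prolongation

/-- The point `(a, δa)` of `K^{2n}`, viewed as a point of `U^{2n}`. -/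
def nabla {K : Type*} (U : Type*) [Field K] [Differential K] [Field U] [Algebra K U] {n : ℕ}
    (a : Fin n → K) : Fin n ⊕ Fin n → U :=
  Sum.elim (fun i => algebraMap K U (a i)) (fun i => algebraMap K U (Differential.deriv (a i)))

end DiffLarge

end

noncomputable section

open MvPolynomial

namespace DiffLarge

/-! ### Derivatives of polynomials along a derivation of the coefficients -/

section CoeffDeriv

variable {K : Type*} [Field K] [Differential K] {σ : Type*}

/-! Both directions pass between a variety `W` and its generic point. Suppose `K` is differentially
large, and let `L` be the function field of `W` over `K`, with generic point `(x, y)`. A smooth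
`K`-point and largeness make `K` existentially closed in `L` as a field (`IsLargeField.isECField`).
The inclusion of `W` in the prolongation says that `y` respects the algebraic relations of `x`, so
in characteristic zero `L` carries a derivation with `δx = y` (`exists_differential`). Then `(x,
δx)` solves the equations of `W` in `L`, and a solution exists in `K`. Conversely, given a solution
in `L`, let `c` list it with its derivatives up to the order of the system, and let `W` be the locus
of `(c, δc)` over `K`. Existential closedness makes `K`-points dense in `W`. Hence one is smooth
(`exists_notMem_isSmoothZero`), and `W` lies in the prolongation of its projection
(`IsECField.zeroLocus_subset_prolongation`). A point `(d, δd)` of `W` satisfies the relations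
linking consecutive entries of `c`, so it encodes a solution in `K`. -/

lemma coeff_coeffDeriv (f : MvPolynomial σ K) (m : σ →₀ ℕ) :
    (coeffDeriv f).coeff m = Differential.deriv (f.coeff m) := by
  classical
  simp only [coeffDeriv, coeff_sum, coeff_monomial]
  rw [Finset.sum_ite_eq']
  split_ifs with h
  · rfl
  · rw [notMem_support_iff.1 h, map_zero]

lemma coeffDeriv_add (f g : MvPolynomial σ K) :
    coeffDeriv (f + g) = coeffDeriv f + coeffDeriv g := by
  ext m
  simp [coeff_coeffDeriv]

lemma coeffDeriv_mul (f g : MvPolynomial σ K) :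
    coeffDeriv (f * g) = f * coeffDeriv g + g * coeffDeriv f := by
  classical
  ext m
  rw [coeff_coeffDeriv, mul_comm g, coeff_add, coeff_mul, coeff_mul, coeff_mul, map_sum,
    ← Finset.sum_add_distrib]
  refine Finset.sum_congr rfl fun p _ => ?_
  simp only [coeff_coeffDeriv, Derivation.leibniz, smul_eq_mul]
  ring

lemma coeffDeriv_C (c : K) : coeffDeriv (C c : MvPolynomial σ K) = C (Differential.deriv c) := by
  classical
  ext m
  rw [coeff_coeffDeriv, coeff_C, coeff_C]
  split_ifs <;> simp

lemma coeffDeriv_X (i : σ) : coeffDeriv (X i : MvPolynomial σ K) = 0 := by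
  classical
  ext m
  rw [coeff_coeffDeriv, coeff_X]
  split_ifs <;> simp

lemma coeffDeriv_map {U : Type*} [Field U] [Differential U] [Algebra K U]
    [DifferentialAlgebra K U] (f : MvPolynomial σ K) :
    coeffDeriv (map (algebraMap K U) f) = map (algebraMap K U) (coeffDeriv f) := by
  ext m
  simp [coeff_coeffDeriv, coeff_map, deriv_algebraMap]

/-- The value at `(x, y)` of the linear form `∑ᵢ ∂f/∂xᵢ yᵢ + f^δ` attached to a polynomial `f`. -/
def twistedDeriv {L : Type*} [Field L] [Algebra K L] [Fintype σ] (x y : σ → L)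
    (f : MvPolynomial σ K) : L :=
  ∑ i, aeval x (pderiv i f) * y i + aeval x (coeffDeriv f)

section Twisted

variable {L : Type*} [Field L] [Algebra K L] [Fintype σ] (x y : σ → L)

lemma twistedDeriv_add (f g : MvPolynomial σ K) :
    twistedDeriv x y (f + g) = twistedDeriv x y f + twistedDeriv x y g := by
  simp only [twistedDeriv, map_add, coeffDeriv_add, add_mul, Finset.sum_add_distrib]
  ring

lemma twistedDeriv_mul (f g : MvPolynomial σ K) :
    twistedDeriv x y (f * g) = aeval x f * twistedDeriv x y g + aeval x g * twistedDeriv x y f := by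
  have h : ∀ i, aeval x (pderiv i (f * g)) * y i =
      aeval x f * (aeval x (pderiv i g) * y i) + aeval x g * (aeval x (pderiv i f) * y i) := by
    intro i
    rw [Derivation.leibniz]
    simp only [smul_eq_mul, map_add, map_mul]
    ring
  simp only [twistedDeriv, coeffDeriv_mul, h, Finset.sum_add_distrib, map_add, map_mul,
    ← Finset.mul_sum]
  ring

lemma twistedDeriv_C (c : K) :
    twistedDeriv x y (C c : MvPolynomial σ K) = algebraMap K L (Differential.deriv c) := by
  simp [twistedDeriv, coeffDeriv_C]

lemma twistedDeriv_X (i : σ) : twistedDeriv x y (X i : MvPolynomial σ K) = y i := by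
  classical
  simp [twistedDeriv, coeffDeriv_X, pderiv_X, Pi.single_apply, apply_ite]

lemma twistedDeriv_zero : twistedDeriv x y (0 : MvPolynomial σ K) = 0 := by
  simpa using twistedDeriv_add x y (0 : MvPolynomial σ K) 0

/-- Along a point `x` with derivative `y`, the twisted derivative computes the derivative of the
value. -/
lemma deriv_aeval [Differential L] [DifferentialAlgebra K L] (f : MvPolynomial σ K) :
    Differential.deriv (aeval x f) = twistedDeriv x (fun i => Differential.deriv (x i)) f := by
  induction f using MvPolynomial.induction_on with
  | C c => simp [twistedDeriv_C, deriv_algebraMap]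
  | add f g hf hg => rw [map_add, map_add, hf, hg, twistedDeriv_add]
  | mul_X f i hf => simp [twistedDeriv_mul, twistedDeriv_X, hf]

/-- The twisted derivative is the same for a polynomial and for its base change. -/
lemma twistedDeriv_map {U : Type*} [Field U] [Differential U] [Algebra K U]
    [DifferentialAlgebra K U] (x y : σ → U) (f : MvPolynomial σ K) :
    twistedDeriv x y (map (algebraMap K U) f) = twistedDeriv x y f := by
  simp [twistedDeriv, coeffDeriv_map, pderiv_map, aeval_map_algebraMap]

end Twisted

lemma mem_prolongation_iff {U : Type*} [Field U] [Differential U] {n : ℕ} {X : Set (Fin n → U)}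
    {w : Fin n ⊕ Fin n → U} :
    w ∈ prolongation X ↔ proj w ∈ X ∧ ∀ f ∈ vanishingIdeal U X,
      twistedDeriv (proj w) (fun i => w (Sum.inr i)) f = 0 := by
  simp [prolongation, twistedDeriv, aeval_eq_eval]

end CoeffDeriv

/-! ### Extension of derivations -/

section Extension

/-- In characteristic zero `L` is formally smooth over the fraction field of `S`, hence over `S`.
The first cotangent homology therefore vanishes and `L ⊗ Ω_S → Ω_L` is injective. A linear
retraction over the field `L` extends the functional defined by `D`. -/
lemma exists_derivation_extension {S L : Type*} [CommRing S] [IsDomain S] [CharZero S] [Field L]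
    [Algebra S L] [FaithfulSMul S L] [Algebra.EssFiniteType S L] (D : Derivation ℤ S L) :
    ∃ D' : Derivation ℤ L L, ∀ s, D' (algebraMap S L s) = D s := by
  let _ := FractionRing.liftAlgebra S L
  have := FractionRing.isScalarTower_liftAlgebra S L
  have : CharZero (FractionRing S) :=
    charZero_of_injective_algebraMap (FaithfulSMul.algebraMap_injective S (FractionRing S))
  have : Algebra.EssFiniteType (FractionRing S) L := .of_comp S _ L
  have : Algebra.FormallySmooth S (FractionRing S) := .of_isLocalization (nonZeroDivisors S)
  have : Algebra.FormallySmooth S L := .comp S (FractionRing S) L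
  have hinj : Function.Injective (KaehlerDifferential.mapBaseChange ℤ S L) := by
    rw [injective_iff_map_eq_zero]
    intro z hz
    obtain ⟨z, rfl⟩ := (Algebra.H1Cotangent.exact_δ_mapBaseChange ℤ S L z).mp hz
    rw [Subsingleton.elim z 0, map_zero]
  obtain ⟨r, hr⟩ := LinearMap.exists_leftInverse_of_injective
    (KaehlerDifferential.mapBaseChange ℤ S L) (LinearMap.ker_eq_bot.2 hinj)
  let φ := (LinearMap.liftBaseChange L D.liftKaehlerDifferential).comp r
  refine ⟨φ.compDer (KaehlerDifferential.D ℤ L), fun s => ?_⟩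
  have h : KaehlerDifferential.D ℤ L (algebraMap S L s) =
      KaehlerDifferential.mapBaseChange ℤ S L (1 ⊗ₜ KaehlerDifferential.D ℤ S s) := by
    simp
  have h' := LinearMap.congr_fun hr (1 ⊗ₜ KaehlerDifferential.D ℤ S s)
  simp only [LinearMap.comp_apply, LinearMap.id_apply] at h'
  change LinearMap.liftBaseChange L D.liftKaehlerDifferential
    (r (KaehlerDifferential.D ℤ L (algebraMap S L s))) = D s
  rw [h, h']
  simp

variable {K : Type*} [Field K] [CharZero K] [Differential K] {σ : Type*} [Fintype σ]
  {L : Type*} [Field L] [Algebra K L] [Algebra.EssFiniteType K L]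

/-- A finitely generated field extension of a differential field carries a derivation with
prescribed values `δxᵢ = yᵢ` as soon as these values respect the algebraic relations between the
`xᵢ`. -/
lemma exists_differential (x y : σ → L)
    (hxy : ∀ f : MvPolynomial σ K, aeval x f = 0 → twistedDeriv x y f = 0) :
    ∃ (_ : Differential L), DifferentialAlgebra K L ∧ ∀ i, Differential.deriv (x i) = y i := by
  let A := (aeval (R := K) x).range
  have hsurj : Function.Surjective (aeval (R := K) x).rangeRestrict :=
    AlgHom.rangeRestrict_surjective _
  let g : A → MvPolynomial σ K := Function.surjInv hsurj
  have hg : ∀ s : A, aeval x (g s) = (s : L) := fun s =>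
    congrArg Subtype.val (Function.surjInv_eq hsurj s)
  -- By `hxy` the twisted derivative depends only on the value at `x`, so the arbitrary choice of
  -- representatives `g` is harmless.
  have key : ∀ f f' : MvPolynomial σ K, aeval x f = aeval x f' →
      twistedDeriv x y f = twistedDeriv x y f' := by
    intro f f' h
    have h0 := hxy (f - f') (by rw [map_sub, h, sub_self])
    have h1 := twistedDeriv_add x y (f - f') f'
    rwa [h0, sub_add_cancel, zero_add] at h1
  let T : A →+ L :=
    { toFun := fun s => twistedDeriv x y (g s)
      map_zero' := (key _ 0 (by rw [hg, map_zero]; rfl)).trans (twistedDeriv_zero x y)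
      map_add' := fun s t => by
        rw [← twistedDeriv_add]
        exact key _ _ (by rw [map_add, hg, hg, hg]; rfl) }
  let D : Derivation ℤ A L := Derivation.mk' T.toIntLinearMap fun s t => by
    change twistedDeriv x y (g (s * t)) =
      (s : L) * twistedDeriv x y (g t) + (t : L) * twistedDeriv x y (g s)
    rw [← hg s, ← hg t, ← twistedDeriv_mul]
    exact key _ _ (by rw [map_mul, hg, hg, hg]; rfl)
  have hD : ∀ f (hf : aeval x f ∈ A), D ⟨aeval x f, hf⟩ = twistedDeriv x y f := fun f hf =>
    key _ _ (hg _)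
  have : CharZero A := charZero_of_injective_algebraMap (algebraMap K A).injective
  have : Algebra.EssFiniteType A L := .of_comp K A L
  obtain ⟨D', hD'⟩ := exists_derivation_extension D
  have hD'' : ∀ f : MvPolynomial σ K, D' (aeval x f) = twistedDeriv x y f := fun f =>
    (hD' ⟨aeval x f, f, rfl⟩).trans (hD f _)
  refine ⟨⟨D'⟩, @DifferentialAlgebra.mk _ _ _ _ _ _ ⟨D'⟩ fun c => ?_, fun i => ?_⟩
  · simpa [twistedDeriv_C] using hD'' (C c)
  · simpa [twistedDeriv_X] using hD'' (X i)

end Extension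

/-! ### Irreducible closed sets and prime ideals -/

section Irreducible

variable {K : Type*} [Field K] {U : Type*} [Field U] [Algebra K U] {σ : Type*}

lemma IsClosedOver.zeroLocus_vanishingIdeal {W : Set (σ → U)} (hW : IsClosedOver K W) :
    zeroLocus U (vanishingIdeal K W) = W := by
  obtain ⟨I, rfl⟩ := hW
  exact zeroLocus_vanishingIdeal_galoisConnection.l_u_l_eq_l I

lemma isClosedOver_inter_zeros {W : Set (σ → U)} (hW : IsClosedOver K W) (f : MvPolynomial σ K) :
    IsClosedOver K (W ∩ {x | aeval x f = 0}) := by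
  obtain ⟨I, rfl⟩ := hW
  refine ⟨I ⊔ Ideal.span {f}, ?_⟩
  ext x
  constructor
  · rintro ⟨hx, hf⟩
    have : I ⊔ Ideal.span {f} ≤ RingHom.ker (aeval (R := K) x) :=
      sup_le hx (by rw [Ideal.span_singleton_le_iff_mem]; exact hf)
    exact this
  · intro hx
    exact ⟨fun p hp => hx p (Ideal.mem_sup_left hp),
      hx f (Ideal.mem_sup_right (Ideal.mem_span_singleton_self f))⟩

lemma IsIrreducibleClosedOver.isPrime_vanishingIdeal {W : Set (σ → U)}
    (hW : IsIrreducibleClosedOver K W) : (vanishingIdeal K W).IsPrime := by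
  obtain ⟨hcl, ⟨x, hx⟩, hirr⟩ := hW
  refine ⟨fun h => ?_, fun {f g} hfg => ?_⟩
  · have := (Ideal.eq_top_iff_one _).1 h x hx
    simp at this
  · have hunion : W = W ∩ {x | aeval x f = 0} ∪ W ∩ {x | aeval x g = 0} := by
      ext z
      refine ⟨fun hz => ?_, fun hz => hz.elim And.left And.left⟩
      have := hfg z hz
      rw [map_mul, mul_eq_zero] at this
      exact this.imp (fun h => ⟨hz, h⟩) fun h => ⟨hz, h⟩
    refine (hirr _ _ (isClosedOver_inter_zeros hcl f) (isClosedOver_inter_zeros hcl g) hunion).imp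
      (fun h z hz => ?_) fun h z hz => ?_
    · rw [h] at hz
      exact hz.2
    · rw [h] at hz
      exact hz.2

/-- By the Nullstellensatz `P` is recovered from its zeros in `U`, so primality turns into
irreducibility. -/
lemma isIrreducibleClosedOver_zeroLocus [IsAlgClosed U] [Finite σ]
    (P : Ideal (MvPolynomial σ K)) [hP : P.IsPrime] :
    IsIrreducibleClosedOver K (zeroLocus U P) := by
  have hv : vanishingIdeal K (zeroLocus U P) = P := IsPrime.vanishingIdeal_zeroLocus P
  refine ⟨⟨P, rfl⟩, ?_, ?_⟩
  · rw [Set.nonempty_iff_ne_empty]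
    intro h
    rw [h, vanishingIdeal_empty] at hv
    exact hP.ne_top hv.symm
  · rintro W₁ W₂ ⟨I, rfl⟩ ⟨J, rfl⟩ h
    have hIJ : I * J ≤ P := by
      rw [← hv, Ideal.mul_le]
      intro f hf g hg x hx
      rw [h] at hx
      rw [map_mul]
      rcases hx with hx | hx
      · rw [hx f hf, zero_mul]
      · rw [hx g hg, mul_zero]
    refine (hP.mul_le.1 hIJ).imp (fun hI => ?_) fun hJ => ?_
    · exact (zeroLocus_anti_mono hI).antisymm (h ▸ Set.subset_union_left)
    · exact (zeroLocus_anti_mono hJ).antisymm (h ▸ Set.subset_union_right)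

end Irreducible

/-! ### Rational points -/

section Points

variable {K : Type*} [Field K] {L : Type*} [Field L] [Algebra K L] {σ : Type*}

lemma IsECField.exists_specialization [Finite σ] (h : IsECField K L) (x : σ → L) :
    ∃ w : σ → K, ∀ f : MvPolynomial σ K, aeval x f = 0 → aeval w f = 0 := by
  obtain ⟨n, ⟨e⟩⟩ := Finite.exists_equiv_fin σ
  obtain ⟨w, hw⟩ := h n (RingHom.ker (aeval (R := K) (x ∘ e.symm))) ⟨x ∘ e.symm, fun p hp => hp⟩
  refine ⟨w ∘ e, fun f hf => ?_⟩
  rw [← aeval_rename]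
  refine hw _ ?_
  rw [RingHom.mem_ker, aeval_rename]
  simpa [Function.comp_assoc] using hf

/-- If `K` is existentially closed in `L`, the `K`-points are dense in the locus of every
`L`-point. -/
lemma IsECField.exists_specialization_ne_zero [Finite σ] (h : IsECField K L) (x : σ → L)
    {g : MvPolynomial σ K} (hg : aeval x g ≠ 0) :
    ∃ w : σ → K, (∀ f : MvPolynomial σ K, aeval x f = 0 → aeval w f = 0) ∧ aeval w g ≠ 0 := by
  -- Rabinowitsch trick: the extra coordinate is an inverse of the value of `g`, and the relation
  -- expressing this survives specialization.
  obtain ⟨w, hw⟩ := h.exists_specialization (fun o : Option σ => o.elim (aeval x g)⁻¹ x)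
  refine ⟨w ∘ some, fun f hf => ?_, fun h0 => ?_⟩
  · rw [← aeval_rename]
    refine hw _ ?_
    rw [aeval_rename]
    exact hf
  · have := hw (rename some g * X none - 1) (by
      rw [map_sub, map_mul, aeval_rename, aeval_X, map_one]
      exact sub_eq_zero.2 (mul_inv_cancel₀ hg))
    rw [map_sub, map_mul, aeval_rename, h0] at this
    simp at this

/-- Largeness is stated for variables indexed by `Fin n`; this transports smooth points to and from
other finite index types. -/
lemma isSmoothZero_map_renameEquiv {τ : Type*} (e : σ ≃ τ) {P : Ideal (MvPolynomial σ K)}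
    {a : σ → K} (ha : IsSmoothZero P a) :
    IsSmoothZero (P.comap (renameEquiv K e.symm).toRingEquiv) (a ∘ e.symm) := by
  obtain ⟨p, hp, hpa⟩ := ha
  let Q := P.comap (renameEquiv K e.symm).toRingEquiv
  let φ : (MvPolynomial τ K ⧸ Q) ≃ₐ[K] (MvPolynomial σ K ⧸ P) :=
    Ideal.quotientEquivAlg Q P (renameEquiv K e.symm) (by
      exact (Ideal.map_comap_of_surjective _ (renameEquiv K e.symm).surjective P).symm)
  let _ : Algebra (MvPolynomial τ K ⧸ Q) (MvPolynomial σ K ⧸ P) := φ.toRingHom.toAlgebra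
  have := IsScalarTower.of_algebraMap_eq (R := K) (S := MvPolynomial τ K ⧸ Q)
    (A := MvPolynomial σ K ⧸ P) fun c => (φ.commutes c).symm
  have : IsLocalization.Away (1 : MvPolynomial τ K ⧸ Q) (MvPolynomial σ K ⧸ P) :=
    -- An isomorphism is a localization away from `1`, and smooth loci are compatible with
    -- localization.
    IsLocalization.away_of_isUnit_of_bijective _ isUnit_one φ.bijective
  rw [← Algebra.smoothLocus_comap_of_isLocalization (1 : MvPolynomial τ K ⧸ Q)] at hp
  refine ⟨_, hp, ?_⟩
  ext f
  have := congrArg (fun I : Ideal (MvPolynomial σ K) => rename e.symm f ∈ I) hpa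
  simp only [Ideal.mem_comap, RingHom.mem_ker, eval_rename] at this
  exact iff_of_eq this

/-- Over a large field, the rational points are dense in a variety with a smooth rational
point. -/
lemma IsLargeField.exists_point [Finite σ] (h : IsLargeField K) (P : Ideal (MvPolynomial σ K))
    [P.IsPrime] {a : σ → K} (ha : IsSmoothZero P a) {g : MvPolynomial σ K} (hg : g ∉ P) :
    ∃ w : σ → K, (∀ f ∈ P, aeval w f = 0) ∧ aeval w g ≠ 0 := by
  obtain ⟨n, ⟨e⟩⟩ := Finite.exists_equiv_fin σ
  have hle := h n _ (Ideal.comap_isPrime (renameEquiv K e.symm).toRingEquiv P)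
    ⟨_, isSmoothZero_map_renameEquiv e ha⟩
  have hre : ∀ f : MvPolynomial σ K, rename e.symm (rename e f) = f := fun f => by
    simp [rename_rename]
  by_contra! hcon
  refine hg ?_
  have hmem := @hle (rename e g) fun w hw => by
    rw [aeval_rename]
    refine hcon _ fun f hf => ?_
    rw [← aeval_rename]
    exact hw _ (show rename e.symm (rename e f) ∈ P by rwa [hre])
  have : rename e.symm (rename e g) ∈ P := hmem
  rwa [hre] at this

end Points

/-! ### Existential closedness in function fields -/

section FunctionField

variable {K : Type u} [Field K] {σ : Type*}

/-- Clearing denominators in the value of a polynomial at a tuple of fractions. -/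
lemma exists_clear_denominators {ι : Type*} (f : ι → MvPolynomial σ K) (g : MvPolynomial σ K)
    (p : MvPolynomial ι K) :
    ∃ (N : ℕ) (q : MvPolynomial σ K), ∀ (E : Type u) [Field E] [Algebra K E] (x : σ → E)
      (d : ι → E), (∀ i, d i * aeval x g = aeval x (f i)) →
        aeval d p * aeval x g ^ N = aeval x q := by
  induction p using MvPolynomial.induction_on with
  | C c => exact ⟨0, C c, fun E _ _ x d _ => by simp⟩
  | add p₁ p₂ h₁ h₂ =>
    obtain ⟨N₁, q₁, h₁⟩ := h₁
    obtain ⟨N₂, q₂, h₂⟩ := h₂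
    refine ⟨N₁ + N₂, q₁ * g ^ N₂ + q₂ * g ^ N₁, fun E _ _ x d hd => ?_⟩
    rw [map_add, map_add, map_mul, map_mul, ← h₁ E x d hd, ← h₂ E x d hd, map_pow, map_pow]
    ring
  | mul_X p i h =>
    obtain ⟨N, q, h⟩ := h
    refine ⟨N + 1, q * f i, fun E _ _ x d hd => ?_⟩
    rw [map_mul, map_mul, aeval_X, ← h E x d hd, ← hd i]
    ring

/-- A large field is existentially closed in the function field of a variety with a smooth
rational point. Here `x` is the generic point of the variety. -/
lemma IsLargeField.isECField [Finite σ] (h : IsLargeField K) (P : Ideal (MvPolynomial σ K))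
    [P.IsPrime] {a : σ → K} (ha : IsSmoothZero P a) {L : Type u} [Field L] [Algebra K L]
    (x : σ → L) (hx : ∀ f : MvPolynomial σ K, aeval x f = 0 ↔ f ∈ P)
    (hfrac : ∀ z : L, ∃ f g : MvPolynomial σ K, aeval x g ≠ 0 ∧ z * aeval x g = aeval x f) :
    IsECField K L := by
  classical
  rintro n I ⟨c, hc⟩
  choose f g hg hfg using fun i => hfrac (c i)
  let G := ∏ i, g i
  have hG : aeval x G ≠ 0 := by
    rw [map_prod]
    exact Finset.prod_ne_zero_iff.2 fun i _ => hg i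
  obtain ⟨w, hw, hwG⟩ := h.exists_point P ha (mt (hx G).2 hG)
  let F : Fin n → MvPolynomial σ K := fun i => f i * ∏ j ∈ Finset.univ.erase i, g j
  refine ⟨fun i => aeval w (F i) / aeval w G, fun p hp => ?_⟩
  -- The same `N` and `q` serve over `L` and over `K`: vanishing of `p` at `c` puts `q` in `P`, so
  -- `q` vanishes at `w`, and hence `p` vanishes at the specialized fractions.
  obtain ⟨N, q, hq⟩ := exists_clear_denominators F G p
  have hqL := hq L x c fun i => by
    rw [map_mul, ← hfg, mul_assoc, ← map_mul, Finset.mul_prod_erase _ _ (Finset.mem_univ i)]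
  rw [hc p hp, zero_mul] at hqL
  have hqK := hq K w (fun i => aeval w (F i) / aeval w G) fun i => div_mul_cancel₀ _ hwG
  rw [hw q ((hx q).1 hqL.symm)] at hqK
  exact (mul_eq_zero.1 hqK).resolve_right (pow_ne_zero N hwG)

end FunctionField

/-! ### Generic smoothness in characteristic zero -/

section GenericSmoothness

variable {K : Type*} [Field K] {σ : Type*}

/-- In characteristic zero, the locus of a point is smooth at the rational points outside of a
proper closed subset. -/
lemma exists_notMem_isSmoothZero [CharZero K] [Finite σ] (P : Ideal (MvPolynomial σ K))
    [P.IsPrime] :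
    ∃ g ∉ P, ∀ w : σ → K, (∀ f ∈ P, aeval w f = 0) → aeval w g ≠ 0 → IsSmoothZero P w := by
  let B := MvPolynomial σ K ⧸ P
  have hfp : Algebra.FinitePresentation K B :=
    Algebra.FinitePresentation.of_finiteType.1 inferInstance
  have hess : Algebra.EssFiniteType K (FractionRing B) :=
    have : Algebra.EssFiniteType B (FractionRing B) := .of_isLocalization _ (nonZeroDivisors B)
    .comp K B _
  -- The local ring at the generic point is the function field, which is formally smooth over `K` in
  -- characteristic zero; smoothness then spreads to a basic open set.
  have hsm : Algebra.IsSmoothAt K (⊥ : Ideal B) := by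
    have hloc : IsLocalization.AtPrime (FractionRing B) (⊥ : Ideal B) := by
      have : (⊥ : Ideal B).primeCompl = nonZeroDivisors B := by
        ext; simp [Ideal.primeCompl, mem_nonZeroDivisors_iff_ne_zero]
      rw [IsLocalization.AtPrime, this]
      infer_instance
    exact Algebra.FormallySmooth.of_equiv ((IsLocalization.algEquiv (⊥ : Ideal B).primeCompl
      (FractionRing B) (Localization.AtPrime (⊥ : Ideal B))).restrictScalars K)
  obtain ⟨b, hb, hbs⟩ := Algebra.IsSmoothAt.exists_notMem_smooth K (⊥ : Ideal B)
  obtain ⟨g, rfl⟩ := Ideal.Quotient.mk_surjective b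
  rw [← Algebra.basicOpen_subset_smoothLocus_iff_smooth] at hbs
  refine ⟨g, fun hg => hb (Ideal.Quotient.eq_zero_iff_mem.2 hg), fun w hw hwg => ?_⟩
  let ψ : B →+* K := Ideal.Quotient.lift P (aeval (R := K) w).toRingHom hw
  refine ⟨⟨RingHom.ker ψ, RingHom.ker_isPrime ψ⟩, hbs ?_, ?_⟩
  · exact hwg
  · ext f
    exact Iff.rfl

end GenericSmoothness

/-! ### The geometric characterisation -/

section Characterisation

variable {K : Type u} [Field K] {n : ℕ}

lemma aeval_rename_inl {E : Type*} [Field E] [Algebra K E] (x : Fin n ⊕ Fin n → E)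
    (f : MvPolynomial (Fin n) K) : aeval x (rename Sum.inl f) = aeval (proj x) f :=
  aeval_rename ..

variable [Differential K]

/-- The polynomial `∑ᵢ ∂f/∂xᵢ yᵢ + f^δ` in the variables `(x, y)`. -/
def twistedPoly (f : MvPolynomial (Fin n) K) : MvPolynomial (Fin n ⊕ Fin n) K :=
  ∑ i, rename Sum.inl (pderiv i f) * X (Sum.inr i) + rename Sum.inl (coeffDeriv f)

lemma aeval_twistedPoly {E : Type*} [Field E] [Algebra K E] (x : Fin n ⊕ Fin n → E)
    (f : MvPolynomial (Fin n) K) :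
    aeval x (twistedPoly f) = twistedDeriv (proj x) (fun i => x (Sum.inr i)) f := by
  simp only [twistedPoly, twistedDeriv, map_add, map_sum, map_mul, aeval_rename, aeval_X]
  rfl

variable {U : Type*} [Field U] [Algebra K U]

lemma nabla_eq_comp (a : Fin n → K) :
    nabla U a = algebraMap K U ∘ nabla K a := by
  funext i
  cases i <;> rfl

lemma nabla_mem_zeroLocus_iff (a : Fin n → K) (I : Ideal (MvPolynomial (Fin n ⊕ Fin n) K)) :
    nabla U a ∈ zeroLocus U I ↔ ∀ f ∈ I, aeval (nabla K a) f = 0 := by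
  rw [mem_zeroLocus_iff, nabla_eq_comp]
  refine forall₂_congr fun f _ => ?_
  rw [show aeval (algebraMap K U ∘ nabla K a) f = algebraMap K U (aeval (nabla K a) f) from
    aeval_algebraMap_apply ..]
  exact map_eq_zero _

variable [Differential U] [DifferentialAlgebra K U]

/-- If `K` is existentially closed in `L`, the locus of a point `(c, δc)` with coordinates in `L`
lies in the prolongation of its projection. -/
lemma IsECField.zeroLocus_subset_prolongation [IsAlgClosed U] {L : Type*} [Field L]
    [Differential L] [Algebra K L] [DifferentialAlgebra K L] (hEC : IsECField K L)
    (c : Fin n → L) {P : Ideal (MvPolynomial (Fin n ⊕ Fin n) K)}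
    (hP : P = RingHom.ker
      (aeval (R := K) (Sum.elim c fun i => Differential.deriv (c i) : Fin n ⊕ Fin n → L))) :
    zeroLocus U P ⊆ prolongation (proj '' zeroLocus U P) := by
  intro w hw
  refine mem_prolongation_iff.2 ⟨⟨w, hw, rfl⟩, fun f hf => ?_⟩
  set z : Fin n ⊕ Fin n → L := Sum.elim c fun i => Differential.deriv (c i) with hz
  have hzP : ∀ g, aeval z g = 0 ↔ g ∈ P := fun g => by rw [hP]; rfl
  -- The prolongation involves polynomials over `U`, while `P` controls only those over `K`. A
  -- `K`-basis of `U` splits `f` into components over `K`.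
  let b := Module.Basis.ofVectorSpace K U
  obtain ⟨s, hs⟩ := TensorProduct.eq_repr_basis_left b
    ((algebraTensorAlgEquiv (σ := Fin n) K U).symm f)
  have hfs : f = s.sum fun k g => C (b k) * map (algebraMap K U) g := by
    rw [← (algebraTensorAlgEquiv (σ := Fin n) K U).apply_symm_apply f, ← hs, Finsupp.sum,
      Finsupp.sum, map_sum]
    simp [algebraTensorAlgEquiv_tmul, smul_eq_C_mul]
  -- A component outside `P` would be nonzero at some `K`-point of the locus; there the vanishing of
  -- `f` is a nontrivial `K`-linear relation between basis elements.
  have hsP : ∀ k, rename Sum.inl (s k) ∈ P := by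
    intro k
    by_contra hk
    obtain ⟨v, hv, hvk⟩ := hEC.exists_specialization_ne_zero z (mt (hzP _).1 hk)
    have hvP : algebraMap K U ∘ v ∈ zeroLocus U P := fun g hg => by
      rw [show aeval (algebraMap K U ∘ v) g = algebraMap K U (aeval v g) from
        aeval_algebraMap_apply .., hv g ((hzP g).2 hg), map_zero]
    have h0 : aeval (algebraMap K U ∘ proj v) f = 0 := hf _ ⟨_, hvP, rfl⟩
    have h1 : ∀ g : MvPolynomial (Fin n) K,
        aeval (R := U) (algebraMap K U ∘ proj v) (map (algebraMap K U) g) =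
          algebraMap K U (aeval (proj v) g) := fun g => by
      rw [aeval_map_algebraMap]
      exact aeval_algebraMap_apply ..
    rw [hfs, Finsupp.sum, map_sum] at h0
    simp only [map_mul, h1, aeval_C, Algebra.algebraMap_self, RingHom.id_apply] at h0
    have h2 : ∑ k ∈ s.support, aeval (proj v) (s k) • b k = 0 := by
      rw [← h0]
      exact Finset.sum_congr rfl fun k _ => by rw [Algebra.smul_def, mul_comm]
    rw [aeval_rename_inl] at hvk
    have hks : k ∈ s.support := by
      rw [Finsupp.mem_support_iff]
      rintro h
      simp [h] at hvk
    exact hvk (linearIndependent_iff'.1 b.linearIndependent _ _ h2 k hks)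
  have hzero : ∀ k, aeval (proj w) (s k) = 0 ∧
      twistedDeriv (proj w) (fun i => w (Sum.inr i)) (s k) = 0 := by
    intro k
    refine ⟨by rw [← aeval_rename_inl]; exact hw _ (hsP k), ?_⟩
    rw [← aeval_twistedPoly]
    refine hw _ ((hzP _).1 ?_)
    have hk := (hzP _).2 (hsP k)
    rw [aeval_rename_inl] at hk
    rw [aeval_twistedPoly]
    have := deriv_aeval (proj z) (s k)
    rw [hk, map_zero] at this
    exact this.symm
  rw [hfs, Finsupp.sum]
  refine Finset.sum_induction _ (fun g => twistedDeriv (proj w) (fun i => w (Sum.inr i)) g = 0)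
    (fun g₁ g₂ h₁ h₂ => by rw [twistedDeriv_add, h₁, h₂, add_zero]) (twistedDeriv_zero _ _) ?_
  intro k _
  -- The scalar `b k` need not be a constant of `δ`, but its derivative is multiplied by the value
  -- of `s k`, which is zero.
  rw [twistedDeriv_mul, twistedDeriv_map, aeval_map_algebraMap, (hzero k).1, (hzero k).2]
  simp

variable [CharZero K]

/-- Over a differentially large field, every irreducible `W ⊆ τ(π(W))` with a smooth rational point
contains a point `(a, δa)`: the function field of `W` carries a derivation for which the generic
point has this form. -/
theorem IsDifferentiallyLarge.exists_nabla_mem (hK : IsDifferentiallyLarge K)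
    {W : Set (Fin n ⊕ Fin n → U)} (hW : IsIrreducibleClosedOver K W) (hs : HasSmoothPoint K W)
    (hτ : W ⊆ prolongation (proj '' W)) : ∃ a : Fin n → K, nabla U a ∈ W := by
  classical
  obtain ⟨a, ha⟩ := hs
  have hP : (vanishingIdeal K W).IsPrime := hW.isPrime_vanishingIdeal
  generalize hPdef : vanishingIdeal K W = P at ha hP
  let B := MvPolynomial (Fin n ⊕ Fin n) K ⧸ P
  let L := FractionRing B
  have : Algebra.EssFiniteType B L := .of_isLocalization _ (nonZeroDivisors B)
  have : Algebra.EssFiniteType K L := .comp K B _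
  let x : Fin n ⊕ Fin n → L := fun i => algebraMap B L (Ideal.Quotient.mk P (X i))
  have hxf : ∀ f : MvPolynomial (Fin n ⊕ Fin n) K,
      aeval x f = algebraMap B L (Ideal.Quotient.mk P f) := fun f => by
    have : aeval x = ((IsScalarTower.toAlgHom K B L).comp (Ideal.Quotient.mkₐ K P)) := by
      ext i
      simp only [aeval_X, x]
      rfl
    exact DFunLike.congr_fun this f
  have hx : ∀ f : MvPolynomial (Fin n ⊕ Fin n) K, aeval x f = 0 ↔ f ∈ P := fun f => by
    rw [hxf, ← Ideal.Quotient.eq_zero_iff_mem,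
      FaithfulSMul.algebraMap_eq_zero_iff]
  have hfrac : ∀ z : L, ∃ f g : MvPolynomial (Fin n ⊕ Fin n) K,
      aeval x g ≠ 0 ∧ z * aeval x g = aeval x f := fun z => by
    obtain ⟨b, c, hc, rfl⟩ := IsFractionRing.div_surjective (A := B) z
    obtain ⟨f, rfl⟩ := Ideal.Quotient.mk_surjective b
    obtain ⟨g, rfl⟩ := Ideal.Quotient.mk_surjective c
    have hg : aeval x g ≠ 0 := by
      rw [hxf]
      exact IsFractionRing.to_map_ne_zero_of_mem_nonZeroDivisors hc
    exact ⟨f, g, hg, by rw [← hxf, ← hxf, div_mul_cancel₀ _ hg]⟩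
  have hEC : IsECField K L := hK.1.isECField P ha x hx hfrac
  -- A relation between the first `n` generic coordinates vanishes on the projection of `W`; by `hτ`
  -- its twisted polynomial vanishes on `W`, hence at the generic point.
  obtain ⟨_, hdiff, hδ⟩ := exists_differential (K := K) (proj x) (fun i => x (Sum.inr i))
    fun f hf => by
      rw [← aeval_rename_inl, hx, ← hPdef] at hf
      rw [← aeval_twistedPoly, hx, ← hPdef]
      intro w hw
      rw [aeval_twistedPoly, ← twistedDeriv_map]
      refine (mem_prolongation_iff.1 (hτ hw)).2 _ ?_
      rintro _ ⟨w', hw', rfl⟩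
      rw [aeval_map_algebraMap, ← aeval_rename_inl]
      exact hf w' hw'
  -- Existential closedness concerns finite systems, so a finite set of generators of `P` is needed.
  obtain ⟨G, hG⟩ : P.FG := IsNoetherian.noetherian P
  let ρ : Fin n ⊕ Fin n → Fin n × ℕ := Sum.elim (fun i => (i, 0)) fun i => (i, 1)
  have hρ : ∀ {E : Type u} [Field E] [Differential E] [Algebra K E] (c : Fin n → E)
      (f : MvPolynomial (Fin n ⊕ Fin n) K), diffEval c (rename ρ f) =
        aeval (Sum.elim c fun i => Differential.deriv (c i)) f := by
    intro E _ _ _ c f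
    rw [diffEval, aeval_rename]
    congr 2
    funext i
    cases i <;> rfl
  obtain ⟨b, hb⟩ := hK.2 L hEC n (G.image (rename ρ)) ⟨proj x, fun f hf => by
    obtain ⟨f, hfG, rfl⟩ := Finset.mem_image.1 hf
    rw [hρ]
    have : (Sum.elim (proj x) fun i => Differential.deriv (proj x i)) = x := by
      funext i
      cases i
      · rfl
      · exact hδ _
    rw [this, hx, ← hG]
    exact Ideal.subset_span hfG⟩
  refine ⟨b, ?_⟩
  rw [← hW.1.zeroLocus_vanishingIdeal, hPdef, nabla_mem_zeroLocus_iff]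
  have hle : P ≤ RingHom.ker (aeval (R := K) (nabla K b)) := by
    rw [← hG]
    refine Ideal.span_le.2 fun f hf => ?_
    have := hb _ (Finset.mem_image_of_mem _ hf)
    rw [hρ] at this
    exact this
  exact fun f hf => hle hf

/-- Points `(a, δa)` on all `W ⊆ τ(π(W))` with a smooth rational point suffice to solve every
system of differential equations solvable in `L`. -/
theorem IsECField.isECDifferential [IsAlgClosed U] {L : Type*} [Field L]
    [Differential L] [Algebra K L] [DifferentialAlgebra K L] (hEC : IsECField K L)
    (hW : ∀ (n : ℕ) (W : Set (Fin n ⊕ Fin n → U)), IsIrreducibleClosedOver K W →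
      HasSmoothPoint K W → W ⊆ prolongation (proj '' W) → ∃ a : Fin n → K, nabla U a ∈ W) :
    IsECDifferential K L := by
  classical
  rintro m S ⟨a, ha⟩
  -- `r` bounds the order of the system; the entries of `c` are the `δʲ aᵢ` with `j ≤ r`.
  let r := (S.biUnion vars).sup Prod.snd
  have hr : ∀ f ∈ S, ∀ p ∈ f.vars, p.2 ≤ r := fun f hf p hp =>
    Finset.le_sup (f := Prod.snd) (Finset.mem_biUnion.2 ⟨f, hf, hp⟩)
  let e : Fin m × Fin (r + 1) ≃ Fin (m * (r + 1)) := finProdFinEquiv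
  let c : Fin (m * (r + 1)) → L := fun k =>
    (fun x : L => Differential.deriv x)^[(e.symm k).2] (a (e.symm k).1)
  have hc : ∀ i j, c (e (i, j)) = (fun x : L => Differential.deriv x)^[j] (a i) := fun i j => by
    simp [c]
  let z : Fin (m * (r + 1)) ⊕ Fin (m * (r + 1)) → L :=
    Sum.elim c fun i => Differential.deriv (c i)
  let P := RingHom.ker (aeval (R := K) z)
  have hP : P.IsPrime := RingHom.ker_isPrime _
  have hsm : HasSmoothPoint K (zeroLocus U P) := by
    obtain ⟨g, hg, hgs⟩ := exists_notMem_isSmoothZero P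
    obtain ⟨w, hw, hwg⟩ := hEC.exists_specialization_ne_zero z hg
    refine ⟨w, ?_⟩
    rw [IsPrime.vanishingIdeal_zeroLocus]
    exact hgs w hw hwg
  obtain ⟨d, hd⟩ := hW _ _ (isIrreducibleClosedOver_zeroLocus P) hsm
    (hEC.zeroLocus_subset_prolongation c rfl)
  rw [nabla_mem_zeroLocus_iff] at hd
  let b : Fin m → K := fun i => d (e (i, 0))
  have hb : ∀ i (j : ℕ) (hj : j < r + 1),
      d (e (i, ⟨j, hj⟩)) = (fun x : K => Differential.deriv x)^[j] (b i) := by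
    intro i j
    induction j with
    | zero => exact fun _ => rfl
    | succ j ih =>
      intro hj
      -- This difference vanishes at `(c, δc)`, since `δ` of the `j`-th derivative is the `j +
      -- 1`-st. At `(d, δd)` it gives the recursion for `d`.
      have := hd (X (Sum.inl (e (i, ⟨j + 1, hj⟩))) - X (Sum.inr (e (i, ⟨j, by omega⟩)))) (by
        rw [RingHom.mem_ker, map_sub, aeval_X, aeval_X, sub_eq_zero]
        simp only [z, Sum.elim_inl, Sum.elim_inr, hc, Function.iterate_succ_apply'])
      rw [map_sub, aeval_X, aeval_X, sub_eq_zero] at this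
      rw [Function.iterate_succ_apply', ← ih (by omega)]
      exact this
  -- `Fin.ofNat` reduces modulo `r + 1`, which changes nothing for the orders `j ≤ r` that occur in
  -- `S`.
  let ρ : Fin m × ℕ → Fin (m * (r + 1)) ⊕ Fin (m * (r + 1)) := fun p =>
    Sum.inl (e (p.1, Fin.ofNat (r + 1) p.2))
  have hofNat : ∀ j (hj : j ≤ r), Fin.ofNat (r + 1) j = ⟨j, by omega⟩ := fun j hj =>
    Fin.ext (Nat.mod_eq_of_lt (by omega))
  refine ⟨b, fun f hf => ?_⟩
  have hL : aeval z (rename ρ f) = diffEval a f := by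
    rw [aeval_rename, diffEval]
    refine eval₂Hom_congr' rfl (fun p hp _ => ?_) rfl
    simp only [Function.comp_apply, ρ, z, Sum.elim_inl, hc, hofNat _ (hr f hf p hp)]
  have hK : aeval (nabla K d) (rename ρ f) = diffEval b f := by
    rw [aeval_rename, diffEval]
    refine eval₂Hom_congr' rfl (fun p hp _ => ?_) rfl
    simp only [Function.comp_apply, ρ, hofNat _ (hr f hf p hp)]
    exact hb _ _ _
  rw [← hK]
  exact hd _ (hL.trans (ha f hf))

end Characterisation
end DiffLarge

end

theorem corollary8p5 {K : Type*} [Field K] [CharZero K] [Differential K]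
    (U : Type*) [Field U] [IsAlgClosed U] [Differential U] [Algebra K U] [DifferentialAlgebra K U]
    (hK : DiffLarge.IsLargeField K) :
    DiffLarge.IsDifferentiallyLarge K ↔
      ∀ (n : ℕ) (W : Set (Fin n ⊕ Fin n → U)),
        DiffLarge.IsIrreducibleClosedOver K W →
        DiffLarge.HasSmoothPoint K W →
        W ⊆ DiffLarge.prolongation (DiffLarge.proj '' W) →
          ∃ a : Fin n → K, DiffLarge.nabla U a ∈ W :=
  ⟨fun h _ _ hW hs hτ => h.exists_nabla_mem hW hs hτ,
    fun h => ⟨hK, fun _ _ _ _ _ hEC => hEC.isECDifferential h⟩⟩
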